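/- **Setting.** Let $n$ nodes be partitioned into $K_*$ nonempty communities; write $i(u)$ for the community of node $u$. A Normal LSM (linear sociability model) network is the random symmetric $n\times n$ matrix $A$ with zero diagonal and, for $u\neq v$ with $i=i(u)$, $j=i(v)$, $$A_{uv}=\gamma_{ij}+\alpha_{ij}Z_u+\beta_{ij}Z_v+\sigma_{ij}\epsilon_{uv},$$ where $\gamma_{ij}=\gamma_{ji}$, $\beta_{ij}=\alpha_{ji}$ are real, $\sigma_{ij}=\sigma_{ji}\ge 0$, $\epsilon_{uv}=\epsilon_{vu}$, and the variables $Z_u$ (one for each node) and $\epsilon_{uv}$ (one for each unordered pair $u\ne v$) are independent $\mathcal N(0,1)$. Let $P_*$ be the network given by the same formula with every $\sigma_{ij}$ replaced by $0$, and let $\sigma_{\max}^2$ be the largest value of $\sigma_{i(u)i(v)}^2$ over $u\ne v$. For a clustering of the nodes into $\hat K$ nonempty clusters, the induced estimate $\hat P$ is the matrix closest to $A$ in Frobenius norm among all symmetric matrices with zero diagonal whose entries are, for $u\ne v$, $u$ in cluster $k$ and $v$ in cluster $l$, of the form $\hat\gamma_{kl}+\hat\alpha_{kl}\hat Z^{(k,l)}_u+\hat\beta_{kl}\hat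 Z^{(l,k)}_v$ with $\hat\gamma_{kl}=\hat\gamma_{lk}$, $\hat\beta_{kl}=\hat\alpha_{lk}$ (the estimated sociabilities of a node may depend on the pair of clusters). For constants $C_1,C_2,C_3>0$ and $0<c<1$ put $$\mathrm{Pen}(n,K)=6\sigma_{\max}^2\left(C_1nK+C_2K^2\log n\right)+\left(6C_3+\tfrac2c\right)\sigma_{\max}^2\left(\log n+n\log K\right).$$ Now let $\hat P$ be the estimate induced by a clustering, among all clusterings into any number $\hat K$ of nonempty clusters, that minimizes $\|A-\hat P\|_F^2+\mathrm{Pen}(n,\hat K)$. **Theorem.** There is an absolute constant $C_0>0$ such that the following holds for all $C_1,C_2\ge C_0$, all $0<c<1$, all $C_3\ge C_0/c$, all $n$, $K_*$ and all Normal LSM networks as above. A minimizing clustering exists for every realization of $A$, and for every $t>0$, with probability at least $1-3e^{-t}$, every minimizing $\hat P$ satisfies $$\|\hat P-P_*\|_F^2\le(1-c)^{-1}\,\mathrm{Pen}(n,K_*)+\frac{C_0}{c}\,\sigma_{\max}^2\,t .$$ In particular, since $C_3 \ge C_0$, the same bound holds with $C_3$ in place of $C_0$. -/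

import Mathlib

open MeasureTheory ProbabilityTheory
open scoped Matrix.Norms.Frobenius

/-- The deterministic part of a Normal linear sociability model on `n` nodes with `K` communities:
the community of every node (no community is empty) and, for every ordered pair of communities
`(i, j)`, the coefficients of the edge weights between a node of `i` and a node of `j`. Edges are
undirected, so reading an edge from either of its ends must give the same weight: this is what
`γ_symm`, `β_eq` and `σ_symm` say (in particular `α i i = β i i`). -/
structure NormalLSM (n K : ℕ) where
  /-- the community of each node -/
  label : Fin n → Fin K
  label_surjective : Function.Surjective label
  γ : Fin K → Fin K → ℝ
  α : Fin K → Fin K → ℝ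
  β : Fin K → Fin K → ℝ
  σ : Fin K → Fin K → ℝ
  γ_symm : ∀ i j, γ i j = γ j i
  β_eq : ∀ i j, β i j = α j i
  σ_symm : ∀ i j, σ i j = σ j i
  σ_nonneg : ∀ i j, 0 ≤ σ i j

namespace NormalLSM

variable {n K : ℕ}

/-- The same generating process with every `σ` set to `0`. -/
def noiseFree (θ : NormalLSM n K) : NormalLSM n K :=
  { θ with
    σ := fun _ _ => 0
    σ_symm := fun _ _ => rfl
    σ_nonneg := fun _ _ => le_rfl }

/-- The weighted adjacency matrix generated from the node sociabilities `Z` and the edge errors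
`ε` (indexed by unordered pairs of nodes): no self-loops, and for `u ≠ v` with `u` in community
`i` and `v` in community `j` the weight is `γ i j + α i j * Z u + β i j * Z v + σ i j * ε {u, v}`. -/
def network (θ : NormalLSM n K) (Z : Fin n → ℝ) (ε : Sym2 (Fin n) → ℝ) :
    Matrix (Fin n) (Fin n) ℝ :=
  Matrix.of fun u v =>
    if u = v then 0
    else θ.γ (θ.label u) (θ.label v) + θ.α (θ.label u) (θ.label v) * Z u
      + θ.β (θ.label u) (θ.label v) * Z v + θ.σ (θ.label u) (θ.label v) * ε s(u, v)

/-- The largest variance parameter over all the edges of the network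
(`0` if there is no edge at all, that is, if `n ≤ 1`). -/
noncomputable def sigmaMaxSq (θ : NormalLSM n K) : ℝ :=
  ⨆ e : {e : Fin n × Fin n // e.1 ≠ e.2}, θ.σ (θ.label e.1.1) (θ.label e.1.2) ^ 2

end NormalLSM

/-- The node sociabilities `Z u` and the errors `ε e`, `e` ranging over the edges (unordered pairs
of distinct nodes), are independent standard normal random variables. -/
structure IsStandardNormalInput {Ω : Type*} [MeasurableSpace Ω] (μ : Measure Ω) {n : ℕ}
    (Z : Fin n → Ω → ℝ) (ε : Sym2 (Fin n) → Ω → ℝ) : Prop where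
  law_Z : ∀ u, HasLaw (Z u) (gaussianReal 0 1) μ
  law_ε : ∀ e : Sym2 (Fin n), ¬ e.IsDiag → HasLaw (ε e) (gaussianReal 0 1) μ
  indep : iIndepFun
    (Sum.elim Z (fun e : {e : Sym2 (Fin n) // ¬ e.IsDiag} => ε e.1)) μ

/-- `P` is a noise-free network of Normal LSM form with respect to the clustering `z`: between
each pair of clusters `(k, l)` it is given by coefficients `γ k l`, `α k l`, `β k l` and by
sociabilities that may depend on the pair of clusters (`Z u l` is the sociability of the node `u`
towards the cluster `l`). There are no self-loops and edges are undirected. -/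
def IsNoiseFreeForm {n K : ℕ} (z : Fin n → Fin K) (P : Matrix (Fin n) (Fin n) ℝ) : Prop :=
  ∃ (γ α β : Fin K → Fin K → ℝ) (Z : Fin n → Fin K → ℝ),
    (∀ k l, γ k l = γ l k) ∧ (∀ k l, β k l = α l k) ∧
    ∀ u v, P u v =
      if u = v then 0
      else γ (z u) (z v) + α (z u) (z v) * Z u (z v) + β (z u) (z v) * Z v (z u)

/-- `P` is the network induced by the clustering `z` from the observed network `A`: among the
noise-free networks with respect to `z`, it is closest to `A` in Frobenius norm. -/
def IsInducedEstimate {n K : ℕ} (A : Matrix (Fin n) (Fin n) ℝ) (z : Fin n → Fin K)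
    (P : Matrix (Fin n) (Fin n) ℝ) : Prop :=
  IsNoiseFreeForm z P ∧ ∀ Q, IsNoiseFreeForm z Q → ‖A - P‖ ≤ ‖A - Q‖

/-- `z` is a best clustering, into `K` nonempty clusters, for the penalty `pen` (a function of the
number of clusters), and `P` is the network that it induces. -/
def IsPenalizedEstimate {n : ℕ} (pen : ℕ → ℝ) (A : Matrix (Fin n) (Fin n) ℝ) (K : ℕ)
    (z : Fin n → Fin K) (P : Matrix (Fin n) (Fin n) ℝ) : Prop :=
  Function.Surjective z ∧ IsInducedEstimate A z P ∧
    ∀ (K' : ℕ) (z' : Fin n → Fin K') (P' : Matrix (Fin n) (Fin n) ℝ),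
      Function.Surjective z' → IsInducedEstimate A z' P' →
        ‖A - P‖ ^ 2 + pen K ≤ ‖A - P'‖ ^ 2 + pen K'

/-- The penalty for `K` communities on `n` nodes; `s` is the largest variance parameter. -/
noncomputable def penalty (C₁ C₂ C₃ c s : ℝ) (n K : ℕ) : ℝ :=
  6 * s * (C₁ * n * K + C₂ * (K : ℝ) ^ 2 * Real.log n)
    + (6 * C₃ + 2 / c) * s * (Real.log n + n * Real.log K)

/-!
For a fixed clustering `z`, the sociabilities towards a cluster absorb all the other coefficients,
so the noise-free networks form a linear space `V` of dimension at most `n * K`, and the induced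
estimate is the orthogonal projection onto `V` of the observed `p + w`, signal plus noise.
Comparing the chosen clustering with the true one, which represents `p` exactly, bounds
`‖Phat - p‖ ^ 2` by `2 ‖V w‖ ^ 2 + 2 |⟪w, p - V p⟫|` and the difference of the penalties.

The noise is a sub-Gaussian vector: it is a combination of orthogonal vectors, one for each edge,
with independent sub-Gaussian coefficients. Replacing the square by the mean of an exponential
linear in an independent Gaussian vector, one gets `‖V w‖ ^ 2 ≲ τ * (dim V + x)` with probability
`1 - exp (-x)`. Since the signal is independent of the noise, `p - V p` may be treated as fixed, so
that `|⟪w, p - V p⟫| ≲ √(τ * x) * ‖p - V p‖`; as `‖p - V p‖ ≤ ‖Phat - p‖`, Young's inequality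
absorbs this term into the left-hand side at the price of the factor `(1 - c)⁻¹`.

A union bound over the clusterings, with `x = log n + n * log K + t` for the `K ^ n` clusterings
into `K` clusters, makes this uniform, and the penalty is what pays for `dim V` and for
`log n + n * log K`.
-/

open scoped NNReal

section StdGaussian

theorem lintegral_exp_gaussianReal (v : ℝ≥0) :
    ∫⁻ x, ENNReal.ofReal (Real.exp x) ∂(gaussianReal 0 v) = ENNReal.ofReal (Real.exp (v / 2)) := by
  have hint : Integrable (fun x => Real.exp x) (gaussianReal 0 v) := by
    simpa only [one_mul] using integrable_exp_mul_gaussianReal (μ := 0) (v := v) 1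
  rw [← ofReal_integral_eq_lintegral_ofReal hint (ae_of_all _ fun x => (Real.exp_pos x).le)]
  simpa [mgf] using congrArg ENNReal.ofReal
    (mgf_gaussianReal (p := gaussianReal 0 v) (X := id) Measure.map_id 1)

theorem lintegral_exp_sq_div_four_gaussianReal :
    ∫⁻ x, ENNReal.ofReal (Real.exp (x ^ 2 / 4)) ∂(gaussianReal 0 1)
      = ENNReal.ofReal √2 := by
  have hdensity : ∀ x : ℝ, (gaussianPDF 0 1 * fun x => ENNReal.ofReal (Real.exp (x ^ 2 / 4))) x
      = ENNReal.ofReal ((√(2 * Real.pi))⁻¹ * Real.exp (-(1 / 4) * x ^ 2)) := by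
    intro x
    rw [Pi.mul_apply, gaussianPDF, ← ENNReal.ofReal_mul (gaussianPDFReal_nonneg 0 1 x),
      gaussianPDFReal, mul_assoc, ← Real.exp_add]
    simp only [NNReal.coe_one, mul_one, sub_zero]
    congr 3
    ring
  rw [gaussianReal_of_var_ne_zero 0 one_ne_zero,
    lintegral_withDensity_eq_lintegral_mul _ (measurable_gaussianPDF 0 1) (by fun_prop)]
  simp_rw [hdensity]
  rw [← ofReal_integral_eq_lintegral_ofReal
    ((integrable_exp_neg_mul_sq (by norm_num)).const_mul _)
    (ae_of_all _ fun x => by positivity), integral_const_mul, integral_gaussian,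
    ← Real.sqrt_inv, ← Real.sqrt_mul (by positivity)]
  congr 2
  field_simp
  norm_num

theorem lintegral_prod_pi {ι : Type*} [Fintype ι] {X : ι → Type*} [∀ i, MeasurableSpace (X i)]
    (ν : ∀ i, Measure (X i)) [∀ i, IsProbabilityMeasure (ν i)] {f : ∀ i, X i → ENNReal}
    (hf : ∀ i, Measurable (f i)) :
    ∫⁻ x, ∏ i, f i (x i) ∂(Measure.pi ν) = ∏ i, ∫⁻ x, f i x ∂(ν i) := by
  rw [lintegral_prod_eq_prod_lintegral_of_indepFun Finset.univ _
    (iIndepFun_pi fun i => (hf i).aemeasurable) fun i => (hf i).comp (measurable_pi_apply i)]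
  exact Finset.prod_congr rfl fun i _ => (measurePreserving_eval ν i).lintegral_comp (hf i)

variable {E : Type*} [NormedAddCommGroup E] [InnerProductSpace ℝ E] [FiniteDimensional ℝ E]
  [MeasurableSpace E] [BorelSpace E]

theorem lintegral_exp_inner_stdGaussian (u : E) :
    ∫⁻ g, ENNReal.ofReal (Real.exp (inner ℝ u g)) ∂(stdGaussian E)
      = ENNReal.ofReal (Real.exp (‖u‖ ^ 2 / 2)) := by
  have hlaw : (stdGaussian E).map (innerSL ℝ u) = gaussianReal 0 (‖u‖₊ ^ 2) := by
    rw [IsGaussian.map_eq_gaussianReal, integral_strongDual_stdGaussian,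
      variance_dual_stdGaussian, innerSL_apply_norm, Real.toNNReal_pow (norm_nonneg u),
      norm_toNNReal]
  have hmap := lintegral_map (μ := stdGaussian E) (f := fun x => ENNReal.ofReal (Real.exp x))
    (by fun_prop) (innerSL ℝ u).measurable
  rw [hlaw, lintegral_exp_gaussianReal] at hmap
  simpa using hmap.symm

theorem lintegral_exp_norm_sq_div_four_stdGaussian :
    ∫⁻ g, ENNReal.ofReal (Real.exp (‖g‖ ^ 2 / 4)) ∂(stdGaussian E)
      = ENNReal.ofReal (√2 ^ Module.finrank ℝ E) := by
  have hprod : ∀ x : Fin (Module.finrank ℝ E) → ℝ,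
      ENNReal.ofReal (Real.exp (‖∑ i, x i • stdOrthonormalBasis ℝ E i‖ ^ 2 / 4))
        = ∏ i, ENNReal.ofReal (Real.exp (x i ^ 2 / 4)) := by
    intro x
    simp_rw [← real_inner_self_eq_norm_sq, (stdOrthonormalBasis ℝ E).orthonormal.inner_sum,
      conj_trivial, ← sq]
    rw [Finset.sum_div, Real.exp_sum, ENNReal.ofReal_prod_of_nonneg fun _ _ => (Real.exp_pos _).le]
  rw [stdGaussian, lintegral_map (by fun_prop) (by fun_prop)]
  simp_rw [hprod]
  rw [lintegral_prod_pi _ (f := fun _ x => ENNReal.ofReal (Real.exp (x ^ 2 / 4)))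
    fun _ => by fun_prop]
  simp only [lintegral_exp_sq_div_four_gaussianReal, Finset.prod_const, Finset.card_univ,
    Fintype.card_fin, ENNReal.ofReal_pow (Real.sqrt_nonneg 2)]

end StdGaussian

theorem measure_lt_le_of_lintegral_exp_le {Ω : Type*} [MeasurableSpace Ω] {μ : Measure Ω}
    {f : Ω → ℝ} (hf : AEMeasurable f μ) {m : ℝ}
    (h : ∫⁻ ω, ENNReal.ofReal (Real.exp (f ω)) ∂μ ≤ ENNReal.ofReal (Real.exp m)) (x : ℝ) :
    μ {ω | m + x < f ω} ≤ ENNReal.ofReal (Real.exp (-x)) := by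
  calc μ {ω | m + x < f ω}
      ≤ μ {ω | ENNReal.ofReal (Real.exp (m + x)) ≤ ENNReal.ofReal (Real.exp (f ω))} :=
        measure_mono fun ω hω => ENNReal.ofReal_le_ofReal (Real.exp_le_exp.2 (le_of_lt hω))
    _ ≤ (∫⁻ ω, ENNReal.ofReal (Real.exp (f ω)) ∂μ) / ENNReal.ofReal (Real.exp (m + x)) :=
        meas_ge_le_lintegral_div (by fun_prop) (by simp [Real.exp_pos]) ENNReal.ofReal_ne_top
    _ ≤ ENNReal.ofReal (Real.exp m) / ENNReal.ofReal (Real.exp (m + x)) := by gcongr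
    _ = ENNReal.ofReal (Real.exp (-x)) := by
        rw [← ENNReal.ofReal_div_of_pos (Real.exp_pos _), ← Real.exp_sub, sub_add_cancel_left]

theorem exists_measurableSet_one_sub_le_measureReal {Ω : Type*} [MeasurableSpace Ω]
    {μ : Measure Ω} [IsProbabilityMeasure μ] {P : Ω → Prop} {p : ℝ} (hp : 0 ≤ p)
    (h : μ {ω | ¬ P ω} ≤ ENNReal.ofReal p) :
    ∃ E, MeasurableSet E ∧ 1 - p ≤ μ.real E ∧ ∀ ω ∈ E, P ω := by
  have hmeas := measurableSet_toMeasurable μ {ω | ¬ P ω}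
  refine ⟨(toMeasurable μ {ω | ¬ P ω})ᶜ, hmeas.compl, ?_, fun ω hω => ?_⟩
  · rw [probReal_compl_eq_one_sub hmeas, measureReal_def, measure_toMeasurable]
    linarith [ENNReal.toReal_le_of_le_ofReal hp h]
  · by_contra hP
    exact hω (subset_toMeasurable μ _ hP)

section SubgaussianTail

variable {Ω : Type*} [MeasurableSpace Ω] {μ : Measure Ω} {X : Ω → ℝ} {σ : ℝ≥0}

theorem hasSubgaussianMGF_of_hasLaw_gaussianReal (hX : HasLaw X (gaussianReal 0 σ) μ) :
    HasSubgaussianMGF X σ μ where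
  integrable_exp_mul t := by
    have := integrable_exp_mul_gaussianReal (μ := 0) (v := σ) t
    rw [← hX.map_eq] at this
    exact this.comp_aemeasurable hX.aemeasurable
  mgf_le t := by simp [mgf_gaussianReal hX.map_eq]

theorem lintegral_exp_le_of_hasSubgaussianMGF (hX : HasSubgaussianMGF X σ μ) :
    ∫⁻ ω, ENNReal.ofReal (Real.exp (X ω)) ∂μ ≤ ENNReal.ofReal (Real.exp (σ / 2)) := by
  have hint := hX.integrable_exp_mul 1
  have hmgf := hX.mgf_le 1
  simp only [mgf, one_mul, one_pow, mul_one] at hint hmgf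
  rw [← ofReal_integral_eq_lintegral_ofReal hint (ae_of_all _ fun ω => (Real.exp_pos _).le)]
  exact ENNReal.ofReal_le_ofReal hmgf

theorem measure_sqrt_lt_le_of_hasSubgaussianMGF [IsFiniteMeasure μ] (hX : HasSubgaussianMGF X σ μ)
    {x : ℝ} (hx : 0 ≤ x) :
    μ {ω | √(2 * σ * x) < X ω} ≤ ENNReal.ofReal (Real.exp (-x)) := by
  obtain rfl | hσ := eq_or_ne σ 0
  · have hnull : μ {ω | √(2 * (0 : ℝ≥0) * x) < X ω} = 0 := by
      rw [measure_eq_zero_iff_ae_notMem]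
      filter_upwards [hX.ae_eq_zero_of_hasSubgaussianMGF_zero] with ω hω
      simp [hω]
    exact hnull.trans_le zero_le
  · have hexponent : -√(2 * σ * x) ^ 2 / (2 * σ) = -x := by
      rw [Real.sq_sqrt (by positivity)]
      field_simp
    calc μ {ω | √(2 * σ * x) < X ω} ≤ μ {ω | √(2 * σ * x) ≤ X ω} :=
          measure_mono (Set.ofPred_subset_ofPred.2 fun _ => le_of_lt)
      _ = ENNReal.ofReal (μ.real {ω | √(2 * σ * x) ≤ X ω}) := (ofReal_measureReal).symm
      _ ≤ ENNReal.ofReal (Real.exp (-x)) :=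
          ENNReal.ofReal_le_ofReal (hexponent ▸ hX.measure_ge_le (Real.sqrt_nonneg _))

theorem measure_sqrt_lt_abs_le_of_hasSubgaussianMGF [IsFiniteMeasure μ]
    (hX : HasSubgaussianMGF X σ μ) {x : ℝ} (hx : 0 ≤ x) :
    μ {ω | √(2 * σ * x) < |X ω|} ≤ 2 * ENNReal.ofReal (Real.exp (-x)) := by
  simp_rw [lt_abs, Set.ofPred_or, two_mul (ENNReal.ofReal _)]
  exact (measure_union_le _ _).trans (add_le_add
    (measure_sqrt_lt_le_of_hasSubgaussianMGF hX hx)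
    (measure_sqrt_lt_le_of_hasSubgaussianMGF hX.neg hx))

end SubgaussianTail

section SubgaussianVector

variable {Ω : Type*} [MeasurableSpace Ω] {E : Type*} [NormedAddCommGroup E]
  [InnerProductSpace ℝ E] [MeasurableSpace E]

/-- A random vector whose scalar product with every vector `v` is sub-Gaussian with variance proxy
`τ * ‖v‖ ^ 2`; in particular it is centered. -/
structure IsSubgaussianVector (w : Ω → E) (τ : ℝ≥0) (μ : Measure Ω) : Prop where
  aemeasurable : AEMeasurable w μ
  hasSubgaussianMGF_inner : ∀ v, HasSubgaussianMGF (fun ω => inner ℝ (w ω) v) (τ * ‖v‖₊ ^ 2) μ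

namespace IsSubgaussianVector

variable {μ : Measure Ω} {w : Ω → E} {τ : ℝ≥0}

theorem measure_sqrt_mul_norm_lt_abs_inner_le [IsFiniteMeasure μ] (hw : IsSubgaussianVector w τ μ)
    (v : E) {x : ℝ} (hx : 0 ≤ x) :
    μ {ω | √(2 * τ * x) * ‖v‖ < |inner ℝ (w ω) v|} ≤ 2 * ENNReal.ofReal (Real.exp (-x)) := by
  have hthreshold : √(2 * ↑(τ * ‖v‖₊ ^ 2) * x) = √(2 * τ * x) * ‖v‖ := by
    rw [NNReal.coe_mul, NNReal.coe_pow, coe_nnnorm, ← mul_assoc, mul_right_comm,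
      Real.sqrt_mul (by positivity), Real.sqrt_sq (norm_nonneg v)]
  exact hthreshold ▸
    measure_sqrt_lt_abs_le_of_hasSubgaussianMGF (hw.hasSubgaussianMGF_inner v) hx

theorem orthogonalProjectionOnto [BorelSpace E] (hw : IsSubgaussianVector w τ μ)
    (V : Submodule ℝ E) [V.HasOrthogonalProjection] :
    IsSubgaussianVector (fun ω => V.orthogonalProjectionOnto (w ω)) τ μ where
  aemeasurable := V.orthogonalProjectionOnto.measurable.comp_aemeasurable hw.aemeasurable
  hasSubgaussianMGF_inner v := by
    simp only [Submodule.inner_orthogonalProjectionOnto_eq_of_mem_right]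
    exact hw.hasSubgaussianMGF_inner (v : E)

variable [FiniteDimensional ℝ E]

theorem ae_eq_zero (hw : IsSubgaussianVector w 0 μ) : w =ᵐ[μ] 0 := by
  have hcoord : ∀ i, (fun ω => inner ℝ (w ω) (stdOrthonormalBasis ℝ E i)) =ᵐ[μ] 0 := fun i =>
    HasSubgaussianMGF.ae_eq_zero_of_hasSubgaussianMGF_zero
      (by simpa using hw.hasSubgaussianMGF_inner (stdOrthonormalBasis ℝ E i))
  filter_upwards [ae_all_iff.2 hcoord] with ω hω
  exact InnerProductSpace.ext_inner_right_basis (stdOrthonormalBasis ℝ E).toBasis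
    fun i => by simpa using hω i

variable [BorelSpace E]

/-- The square is linearized by an independent standard Gaussian vector `g`: conditionally on `w`,
`exp (‖w‖ ^ 2 / (4 τ))` is the mean of `exp (⟪w, g⟫ / √(2 τ))`. -/
theorem lintegral_exp_norm_sq_div_le [SFinite μ] (hw : IsSubgaussianVector w τ μ) (hτ : τ ≠ 0) :
    ∫⁻ ω, ENNReal.ofReal (Real.exp (‖w ω‖ ^ 2 / (4 * τ))) ∂μ
      ≤ ENNReal.ofReal (√2 ^ Module.finrank ℝ E) := by
  have := hw.aemeasurable
  have hsq : √(2 * τ)⁻¹ ^ 2 = (2 * τ : ℝ)⁻¹ := Real.sq_sqrt (by positivity)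
  calc ∫⁻ ω, ENNReal.ofReal (Real.exp (‖w ω‖ ^ 2 / (4 * τ))) ∂μ
      = ∫⁻ ω, ∫⁻ g, ENNReal.ofReal (Real.exp (inner ℝ (√(2 * τ)⁻¹ • w ω) g))
          ∂(stdGaussian E) ∂μ := by
        refine lintegral_congr fun ω => ?_
        rw [lintegral_exp_inner_stdGaussian, norm_smul, mul_pow, Real.norm_eq_abs, sq_abs, hsq]
        congr 2
        field_simp
        norm_num
    _ = ∫⁻ g, ∫⁻ ω, ENNReal.ofReal (Real.exp (inner ℝ (√(2 * τ)⁻¹ • w ω) g))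
          ∂μ ∂(stdGaussian E) :=
        lintegral_lintegral_swap (by fun_prop)
    _ ≤ ∫⁻ g, ENNReal.ofReal (Real.exp (‖g‖ ^ 2 / 4)) ∂(stdGaussian E) := by
        refine lintegral_mono fun g => ?_
        have hmgf := lintegral_exp_le_of_hasSubgaussianMGF
          (hw.hasSubgaussianMGF_inner (√(2 * τ)⁻¹ • g))
        simp only [inner_smul_left, inner_smul_right, conj_trivial] at hmgf ⊢
        refine hmgf.trans_eq ?_
        push_cast
        rw [norm_smul, mul_pow, Real.norm_eq_abs, sq_abs, hsq]
        congr 2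
        field_simp
        ring
    _ = ENNReal.ofReal (√2 ^ Module.finrank ℝ E) := lintegral_exp_norm_sq_div_four_stdGaussian

theorem measure_lt_norm_sq_le [SFinite μ] (hw : IsSubgaussianVector w τ μ) (x : ℝ) :
    μ {ω | 2 * τ * (Module.finrank ℝ E + 2 * x) < ‖w ω‖ ^ 2} ≤ ENNReal.ofReal (Real.exp (-x)) := by
  obtain rfl | hτ := eq_or_ne τ 0
  · have hnull : μ {ω | 2 * (0 : ℝ≥0) * (Module.finrank ℝ E + 2 * x) < ‖w ω‖ ^ 2} = 0 := by
      rw [measure_eq_zero_iff_ae_notMem]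
      filter_upwards [hw.ae_eq_zero] with ω hω
      simp [hω]
    exact hnull.trans_le zero_le
  · have := hw.aemeasurable
    have hsqrt : √2 ≤ Real.exp (1 / 2) := by
      rw [Real.sqrt_le_left (Real.exp_pos _).le, ← Real.exp_nat_mul]
      have := Real.add_one_le_exp 1
      norm_num at this ⊢
      linarith
    have hexp : √2 ^ Module.finrank ℝ E ≤ Real.exp (Module.finrank ℝ E / 2) := by
      rw [div_eq_mul_one_div, Real.exp_nat_mul]
      gcongr
    have htail := measure_lt_le_of_lintegral_exp_le (by fun_prop)
      ((hw.lintegral_exp_norm_sq_div_le hτ).trans (ENNReal.ofReal_le_ofReal hexp)) x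
    convert htail using 4 with ω
    rw [lt_div_iff₀ (by positivity)]
    ring_nf

end IsSubgaussianVector

theorem isSubgaussianVector_sum_smul [BorelSpace E] {μ : Measure Ω} {ι : Type*} [Fintype ι]
    {ξ : ι → Ω → ℝ} {w : ι → E} {τ : ℝ≥0} (hindep : iIndepFun ξ μ)
    (hξ : ∀ i, HasSubgaussianMGF (ξ i) 1 μ)
    (hw : ∀ v, ∑ i, inner ℝ (w i) v ^ 2 ≤ τ * ‖v‖ ^ 2) :
    IsSubgaussianVector (fun ω => ∑ i, ξ i ω • w i) τ μ where
  aemeasurable := by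
    have hcont : Continuous fun x : ι → ℝ => ∑ i, x i • w i := by fun_prop
    exact hcont.measurable.comp_aemeasurable (aemeasurable_pi_lambda _ fun i => (hξ i).aemeasurable)
  hasSubgaussianMGF_inner v := by
    have hterm : ∀ i, HasSubgaussianMGF (fun ω => inner ℝ (w i) v * ξ i ω)
        (‖inner ℝ (w i) v‖₊ ^ 2) μ := fun i => by
      convert! (hξ i).const_mul (inner ℝ (w i) v) using 1
      ext
      exact (sq_abs _).trans (mul_one _).symm
    have hsum := HasSubgaussianMGF.sum_of_iIndepFun
      (hindep.comp (fun i x => inner ℝ (w i) v * x) fun i => by fun_prop) (s := Finset.univ)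
      fun i _ => hterm i
    simp only [Function.comp_apply, sum_inner, real_inner_smul_left, mul_comm _ (inner ℝ _ v)]
      at hsum ⊢
    refine ⟨hsum.integrable_exp_mul, fun t => (hsum.mgf_le t).trans ?_⟩
    gcongr
    rw [← NNReal.coe_le_coe]
    simpa using hw v

end SubgaussianVector

theorem indepFun_sumElim {Ω : Type*} [MeasurableSpace Ω] {μ : Measure Ω} {ι κ : Type*}
    [Finite ι] [Finite κ] {X : ι → Ω → ℝ} {Y : κ → Ω → ℝ} (h : iIndepFun (Sum.elim X Y) μ)
    (hX : ∀ i, AEMeasurable (X i) μ) (hY : ∀ j, AEMeasurable (Y j) μ) :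
    IndepFun (fun ω i => X i ω) (fun ω j => Y j ω) μ := by
  classical
  cases nonempty_fintype ι
  cases nonempty_fintype κ
  let S : Finset (ι ⊕ κ) := Finset.univ.map .inl
  let T : Finset (ι ⊕ κ) := Finset.univ.map .inr
  have hdisj : Disjoint S T := Finset.disjoint_map_inl_map_inr _ _
  have hST := h.indepFun_finset₀ S T hdisj (Sum.forall.2 ⟨hX, hY⟩)
  exact hST.comp (φ := fun (f : S → ℝ) i => f ⟨Sum.inl i, by simp [S]⟩)
    (ψ := fun (f : T → ℝ) j => f ⟨Sum.inr j, by simp [T]⟩) (by fun_prop) (by fun_prop)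

theorem measure_prodMk_mem_le_of_indepFun {Ω 𝓧 𝓨 : Type*} [MeasurableSpace Ω] [MeasurableSpace 𝓧]
    [MeasurableSpace 𝓨] {μ : Measure Ω} [IsProbabilityMeasure μ] {X : Ω → 𝓧} {Y : Ω → 𝓨}
    (hXY : IndepFun X Y μ) (hX : AEMeasurable X μ) (hY : AEMeasurable Y μ) {S : Set (𝓧 × 𝓨)}
    (hS : MeasurableSet S) {p : ENNReal} (hp : ∀ x, μ {ω | (x, Y ω) ∈ S} ≤ p) :
    μ {ω | (X ω, Y ω) ∈ S} ≤ p := by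
  have := Measure.isProbabilityMeasure_map hX
  have := Measure.isProbabilityMeasure_map hY
  calc μ {ω | (X ω, Y ω) ∈ S}
      = (μ.map fun ω => (X ω, Y ω)) S := (Measure.map_apply_of_aemeasurable (hX.prodMk hY) hS).symm
    _ = ((μ.map X).prod (μ.map Y)) S := by rw [(indepFun_iff_map_prod_eq_prod_map_map hX hY).1 hXY]
    _ = ∫⁻ x, μ {ω | (x, Y ω) ∈ S} ∂(μ.map X) := by
        rw [Measure.prod_apply hS]
        exact lintegral_congr fun x =>
          Measure.map_apply_of_aemeasurable hY (measurable_prodMk_left hS)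
    _ ≤ ∫⁻ _, p ∂(μ.map X) := lintegral_mono hp
    _ = p := by simp

section ControlledNoise

variable {E : Type*} [NormedAddCommGroup E] [InnerProductSpace ℝ E]

/-- The two deviation bounds, at confidence level `x`, that the noise `w` has to satisfy for the
projection of `p + w` onto `V` to be a good estimate of the signal `p`: the noise inside `V` is not
much larger than `√(τ * dim V)`, and the noise along the residual of the signal is not much larger
than `√τ`. -/
structure IsControlledNoise (V : Submodule ℝ E) [V.HasOrthogonalProjection] (τ : ℝ≥0) (x : ℝ)
    (p w : E) : Prop where
  norm_starProjection_sq_le : ‖V.starProjection w‖ ^ 2 ≤ 2 * τ * (Module.finrank ℝ V + 2 * x)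
  abs_inner_residual_le :
    |inner ℝ w (p - V.starProjection p)| ≤ √(2 * τ * x) * ‖p - V.starProjection p‖

variable [MeasurableSpace E] [BorelSpace E] {Ω : Type*} [MeasurableSpace Ω] {μ : Measure Ω}
  [IsProbabilityMeasure μ]

theorem IsSubgaussianVector.measure_sqrt_mul_norm_lt_abs_inner_le_of_indepFun
    [SecondCountableTopology E] {w r : Ω → E} {τ : ℝ≥0} (hw : IsSubgaussianVector w τ μ)
    (hr : AEMeasurable r μ) (hrw : IndepFun r w μ) {x : ℝ} (hx : 0 ≤ x) :
    μ {ω | √(2 * τ * x) * ‖r ω‖ < |inner ℝ (w ω) (r ω)|} ≤ 2 * ENNReal.ofReal (Real.exp (-x)) := by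
  have hmeas : MeasurableSet {q : E × E | √(2 * τ * x) * ‖q.1‖ < |inner ℝ q.2 q.1|} :=
    (isOpen_lt (by fun_prop) (by fun_prop)).measurableSet
  exact measure_prodMk_mem_le_of_indepFun hrw hr hw.aemeasurable hmeas
    fun v => hw.measure_sqrt_mul_norm_lt_abs_inner_le v hx

theorem IsSubgaussianVector.measure_not_isControlledNoise_le
    [SecondCountableTopology E] {p w : Ω → E} {τ : ℝ≥0} (hw : IsSubgaussianVector w τ μ)
    (hp : AEMeasurable p μ) (hpw : IndepFun p w μ) (V : Submodule ℝ E) [FiniteDimensional ℝ V]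
    {x : ℝ} (hx : 0 ≤ x) :
    μ {ω | ¬ IsControlledNoise V τ x (p ω) (w ω)} ≤ 3 * ENNReal.ofReal (Real.exp (-x)) := by
  have hresidual : Measurable fun q : E => q - V.starProjection q :=
    Continuous.measurable (by fun_prop)
  have hprojection := (hw.orthogonalProjectionOnto V).measure_lt_norm_sq_le x
  have hinner := hw.measure_sqrt_mul_norm_lt_abs_inner_le_of_indepFun
    (hresidual.comp_aemeasurable hp) (hpw.comp hresidual measurable_id) hx
  calc μ {ω | ¬ IsControlledNoise V τ x (p ω) (w ω)}
      ≤ μ ({ω | 2 * τ * (Module.finrank ℝ V + 2 * x) < ‖V.orthogonalProjectionOnto (w ω)‖ ^ 2} ∪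
          {ω | √(2 * τ * x) * ‖p ω - V.starProjection (p ω)‖
            < |inner ℝ (w ω) (p ω - V.starProjection (p ω))|}) := by
        refine measure_mono fun ω hω => ?_
        contrapose! hω
        simp only [Set.mem_union, Set.mem_ofPred_eq, not_or, not_lt, not_not] at hω ⊢
        exact ⟨hω.1, hω.2⟩
    _ ≤ ENNReal.ofReal (Real.exp (-x)) + 2 * ENNReal.ofReal (Real.exp (-x)) :=
        (measure_union_le _ _).trans (add_le_add hprojection hinner)
    _ = 3 * ENNReal.ofReal (Real.exp (-x)) := by ring

end ControlledNoise

section Projection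

variable {E : Type*} [NormedAddCommGroup E] [InnerProductSpace ℝ E]

theorem sum_inner_sq_le_of_pairwise_orthogonal {ι : Type*} [Fintype ι] {w : ι → E} {τ : ℝ≥0}
    (horth : Pairwise fun i j => inner ℝ (w i) (w j) = 0) (hnorm : ∀ i, ‖w i‖ ^ 2 ≤ τ) (v : E) :
    ∑ i, inner ℝ (w i) v ^ 2 ≤ τ * ‖v‖ ^ 2 := by
  set S := ∑ i, inner ℝ (w i) v ^ 2
  set u := ∑ i, inner ℝ (w i) v • w i with hu
  have hS : 0 ≤ S := Finset.sum_nonneg fun _ _ => sq_nonneg _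
  have hinner : inner ℝ u v = S := by simp [hu, S, sum_inner, real_inner_smul_left, sq]
  have hinner_u : ∀ i, inner ℝ (w i) u = inner ℝ (w i) v * ‖w i‖ ^ 2 := by
    intro i
    rw [hu, inner_sum, Finset.sum_eq_single i]
    · rw [real_inner_smul_right, real_inner_self_eq_norm_sq]
    · intro j _ hji
      rw [real_inner_smul_right, horth hji.symm, mul_zero]
    · exact fun hi => absurd (Finset.mem_univ i) hi
  have hnorm_u : ‖u‖ ^ 2 ≤ τ * S := calc
    ‖u‖ ^ 2 = ∑ i, ‖w i‖ ^ 2 * inner ℝ (w i) v ^ 2 := by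
      rw [← real_inner_self_eq_norm_sq]
      nth_rw 1 [hu]
      simp_rw [sum_inner, real_inner_smul_left, hinner_u]
      exact Finset.sum_congr rfl fun _ _ => by ring
    _ ≤ ∑ i, τ * inner ℝ (w i) v ^ 2 := by
      gcongr with i
      exact hnorm i
    _ = τ * S := (Finset.mul_sum _ _ _).symm
  have hsq : S * S ≤ S * (τ * ‖v‖ ^ 2) := calc
    S * S ≤ (‖u‖ * ‖v‖) ^ 2 := by
      rw [← sq, ← hinner, sq_le_sq, abs_mul, abs_norm, abs_norm]
      exact abs_real_inner_le_norm u v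
    _ ≤ S * (τ * ‖v‖ ^ 2) := by
      rw [mul_pow]
      nlinarith [sq_nonneg ‖v‖]
  obtain hS0 | hS0 := hS.eq_or_lt
  · rw [← hS0]
    positivity
  · exact le_of_mul_le_mul_left hsq hS0

variable (V : Submodule ℝ E) [V.HasOrthogonalProjection]

theorem norm_sub_starProjection_le (a : E) {q : E} (hq : q ∈ V) :
    ‖a - V.starProjection a‖ ≤ ‖a - q‖ := by
  rw [V.starProjection_minimal]
  exact ciInf_le ⟨0, Set.forall_mem_range.2 fun _ => norm_nonneg _⟩ (⟨q, hq⟩ : V)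

theorem eq_starProjection_iff_forall_norm_sub_le (a : E) {p : E} (hp : p ∈ V) :
    p = V.starProjection a ↔ ∀ q ∈ V, ‖a - p‖ ≤ ‖a - q‖ := by
  refine ⟨fun h q hq => h ▸ norm_sub_starProjection_le V a hq, fun h => ?_⟩
  have hmin : ‖a - p‖ = ⨅ q : V, ‖a - q‖ :=
    (V.starProjection_minimal (y := a)) ▸
      (h _ (V.starProjection_apply_mem a)).antisymm (norm_sub_starProjection_le V a hp)
  exact (Submodule.eq_starProjection_of_mem_of_inner_eq_zero hp
    ((V.norm_eq_iInf_iff_real_inner_eq_zero hp).1 hmin)).symm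

theorem norm_sq_le_of_penalized_le {p w : E} {penHat penStar : ℝ}
    (h : ‖p + w - V.starProjection (p + w)‖ ^ 2 + penHat ≤ ‖w‖ ^ 2 + penStar) :
    ‖V.starProjection (p + w) - p‖ ^ 2 ≤ 2 * ‖V.starProjection w‖ ^ 2
        + 2 * |inner ℝ w (p - V.starProjection p)| + penStar - penHat := by
  set r := p - V.starProjection p with hr
  set q := V.starProjection w with hq
  have herror : V.starProjection (p + w) - p = q - r := by
    rw [map_add, hr, hq]
    abel
  have hresidual : p + w - V.starProjection (p + w) = w - (q - r) := by
    rw [← herror]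
    abel
  have hwq : inner ℝ w q = ‖q‖ ^ 2 := by
    have horth := V.starProjection_inner_eq_zero w q (V.starProjection_apply_mem w)
    rw [inner_sub_left, ← hq, real_inner_self_eq_norm_sq] at horth
    linarith
  rw [hresidual, norm_sub_sq_real, inner_sub_right, hwq] at h
  rw [herror]
  linarith [neg_abs_le (inner ℝ w r)]

variable {V}

theorem IsControlledNoise.two_mul_abs_inner_residual_le {p w : E} {τ : ℝ≥0} {x c : ℝ}
    (hnoise : IsControlledNoise V τ x p w) (hx : 0 ≤ x) (hc : 0 < c) :
    2 * |inner ℝ w (p - V.starProjection p)|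
      ≤ c * ‖p - V.starProjection p‖ ^ 2 + 2 * τ * x / c := by
  set r := ‖p - V.starProjection p‖
  have hsqrt : √(2 * τ * x) ^ 2 = 2 * τ * x := Real.sq_sqrt (by positivity)
  have hsq : 0 ≤ (c * r - √(2 * τ * x)) ^ 2 / c := by positivity
  have hexpand : (c * r - √(2 * τ * x)) ^ 2 / c
      = c * r ^ 2 + √(2 * τ * x) ^ 2 / c - 2 * (√(2 * τ * x) * r) := by
    field_simp
    ring
  rw [hexpand, hsqrt] at hsq
  linarith [hnoise.abs_inner_residual_le]

theorem IsControlledNoise.norm_sq_starProjection_add_sub_le {p w : E} {τ : ℝ≥0}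
    {c x t penHat penStar : ℝ} (hc : 0 < c) (hc1 : c < 1) (hx : 0 ≤ x) (ht : 0 ≤ t)
    (hnoise : IsControlledNoise V τ (x + t) p w) (hStar : 0 ≤ penStar)
    (hHat : 4 * τ * Module.finrank ℝ V + 12 * τ * x / c ≤ penHat)
    (h : ‖p + w - V.starProjection (p + w)‖ ^ 2 + penHat ≤ ‖w‖ ^ 2 + penStar) :
    ‖V.starProjection (p + w) - p‖ ^ 2 ≤ (1 - c)⁻¹ * penStar + 24 * τ * t / c := by
  set D := ‖V.starProjection (p + w) - p‖
  have hcross : 2 * |inner ℝ w (p - V.starProjection p)| ≤ c / 2 * D ^ 2 + 4 * τ * (x + t) / c := by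
    have hr : ‖p - V.starProjection p‖ ≤ D := by
      simpa only [D, norm_sub_rev] using
        norm_sub_starProjection_le V p (V.starProjection_apply_mem (p + w))
    calc 2 * |inner ℝ w (p - V.starProjection p)|
        ≤ c / 2 * ‖p - V.starProjection p‖ ^ 2 + 2 * τ * (x + t) / (c / 2) :=
          hnoise.two_mul_abs_inner_residual_le (by positivity) (by positivity)
      _ = c / 2 * ‖p - V.starProjection p‖ ^ 2 + 4 * τ * (x + t) / c := by
          field_simp
          ring
      _ ≤ c / 2 * D ^ 2 + 4 * τ * (x + t) / c := by gcongr
  have hbound : (1 - c / 2) * D ^ 2 ≤ penStar + 12 * τ * t / c := by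
    have hbasic := norm_sq_le_of_penalized_le V h
    have hproj := hnoise.norm_starProjection_sq_le
    have hdiv : 8 * τ * (x + t) ≤ 8 * τ * (x + t) / c := by
      rw [le_div_iff₀ hc]
      exact mul_le_of_le_one_right (by positivity) hc1.le
    have hsum : 8 * τ * (x + t) / c + 4 * τ * (x + t) / c = 12 * τ * x / c + 12 * τ * t / c := by
      ring
    linarith
  calc D ^ 2 ≤ (1 - c / 2)⁻¹ * (penStar + 12 * τ * t / c) :=
        (le_inv_mul_iff₀ (by linarith)).2 hbound
    _ ≤ (1 - c)⁻¹ * penStar + 2 * (12 * τ * t / c) := by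
        rw [mul_add]
        gcongr
        · linarith
        · rw [inv_le_comm₀ (by linarith) two_pos]
          linarith
    _ = (1 - c)⁻¹ * penStar + 24 * τ * t / c := by ring

end Projection

/-- The entries of a matrix, as an isometry from the Frobenius norm to the Euclidean norm. -/
noncomputable def matrixVec {m n : Type*} [Fintype m] [Fintype n] :
    Matrix m n ℝ ≃ₗᵢ[ℝ] EuclideanSpace ℝ (m × n) where
  toFun A := WithLp.toLp 2 fun p => A p.1 p.2
  invFun v := Matrix.of fun i j => v (i, j)
  map_add' _ _ := rfl
  map_smul' _ _ := rfl
  left_inv _ := rfl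
  right_inv _ := rfl
  norm_map' A := by
    change ‖WithLp.toLp 2 fun p : m × n => A p.1 p.2‖ = ‖A‖
    rw [EuclideanSpace.norm_eq, Matrix.frobenius_norm_def, Real.sqrt_eq_rpow, Fintype.sum_prod_type]
    simp

theorem matrixVec_apply {m n : Type*} [Fintype m] [Fintype n] (A : Matrix m n ℝ) (p : m × n) :
    matrixVec A p = A p.1 p.2 := rfl

theorem norm_matrixVec_sub {m n : Type*} [Fintype m] [Fintype n] (A B : Matrix m n ℝ) :
    ‖matrixVec A - matrixVec B‖ = ‖A - B‖ := by
  rw [← map_sub, LinearIsometryEquiv.norm_map]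

section InducedEstimate

variable {n K : ℕ}

/-- The noise-free network, for the clustering `z`, in which the node `u` has sociability `a u l`
towards the cluster `l`. The coefficients of `IsNoiseFreeForm` can all be absorbed into these
sociabilities, which is what makes the noise-free networks a linear space. -/
noncomputable def sociabilityMap (z : Fin n → Fin K) :
    (Fin n → Fin K → ℝ) →ₗ[ℝ] EuclideanSpace ℝ (Fin n × Fin n) where
  toFun a := WithLp.toLp 2 fun p => if p.1 = p.2 then 0 else a p.1 (z p.2) + a p.2 (z p.1)
  map_add' a b := by
    ext p
    by_cases h : p.1 = p.2 <;> simp [h, add_add_add_comm]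
  map_smul' r a := by
    ext p
    by_cases h : p.1 = p.2 <;> simp [h, mul_add]

/-- The linear space of noise-free networks with respect to the clustering `z`. -/
noncomputable def noiseFreeForms (z : Fin n → Fin K) :
    Submodule ℝ (EuclideanSpace ℝ (Fin n × Fin n)) :=
  LinearMap.range (sociabilityMap z)

theorem finrank_noiseFreeForms_le (z : Fin n → Fin K) :
    Module.finrank ℝ (noiseFreeForms z) ≤ n * K := by
  refine (LinearMap.finrank_range_le _).trans_eq ?_
  simp [Module.finrank_pi_fintype]

theorem isNoiseFreeForm_iff_mem_noiseFreeForms {z : Fin n → Fin K}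
    {P : Matrix (Fin n) (Fin n) ℝ} : IsNoiseFreeForm z P ↔ matrixVec P ∈ noiseFreeForms z := by
  constructor
  · rintro ⟨γ, α, β, Z, hγ, hβ, hP⟩
    refine ⟨fun u l => γ (z u) l / 2 + α (z u) l * Z u l, ?_⟩
    ext p
    rw [matrixVec_apply, hP]
    by_cases h : p.1 = p.2
    · simp [sociabilityMap, h]
    · simp only [sociabilityMap, LinearMap.coe_mk, AddHom.coe_mk, h, if_false]
      rw [hβ, hγ (z p.2)]
      ring
  · rintro ⟨a, ha⟩
    refine ⟨fun _ _ => 0, fun _ _ => 1, fun _ _ => 1, a, fun _ _ => rfl, fun _ _ => rfl,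
      fun u v => ?_⟩
    rw [← matrixVec_apply P (u, v), ← ha]
    simp [sociabilityMap]

theorem isInducedEstimate_iff_eq_starProjection {z : Fin n → Fin K}
    {A P : Matrix (Fin n) (Fin n) ℝ} :
    IsInducedEstimate A z P ↔ matrixVec P = (noiseFreeForms z).starProjection (matrixVec A) := by
  have hclosest (hP : matrixVec P ∈ noiseFreeForms z) :
      matrixVec P = (noiseFreeForms z).starProjection (matrixVec A) ↔
        ∀ Q, IsNoiseFreeForm z Q → ‖A - P‖ ≤ ‖A - Q‖ := by
    simp_rw [eq_starProjection_iff_forall_norm_sub_le _ _ hP, ← norm_matrixVec_sub,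
      isNoiseFreeForm_iff_mem_noiseFreeForms]
    exact (matrixVec.surjective.forall (p := fun q => q ∈ noiseFreeForms z →
      ‖matrixVec A - matrixVec P‖ ≤ ‖matrixVec A - q‖))
  rw [IsInducedEstimate, isNoiseFreeForm_iff_mem_noiseFreeForms]
  refine ⟨fun h => (hclosest h.1).2 h.2, fun h => ?_⟩
  have hP : matrixVec P ∈ noiseFreeForms z := h ▸ Submodule.starProjection_apply_mem _ _
  exact ⟨hP, (hclosest hP).1 h⟩

theorem exists_isInducedEstimate (A : Matrix (Fin n) (Fin n) ℝ) (z : Fin n → Fin K) :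
    ∃ P, IsInducedEstimate A z P :=
  ⟨matrixVec.symm ((noiseFreeForms z).starProjection (matrixVec A)),
    isInducedEstimate_iff_eq_starProjection.2 (matrixVec.apply_symm_apply _)⟩

theorem IsInducedEstimate.unique {A P Q : Matrix (Fin n) (Fin n) ℝ} {z : Fin n → Fin K}
    (hP : IsInducedEstimate A z P) (hQ : IsInducedEstimate A z Q) : P = Q :=
  matrixVec.injective ((isInducedEstimate_iff_eq_starProjection.1 hP).trans
    (isInducedEstimate_iff_eq_starProjection.1 hQ).symm)

theorem exists_isPenalizedEstimate (pen : ℕ → ℝ) (A : Matrix (Fin n) (Fin n) ℝ) :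
    ∃ (K : ℕ) (z : Fin n → Fin K) (P : Matrix (Fin n) (Fin n) ℝ),
      IsPenalizedEstimate pen A K z P := by
  choose P hP using fun (K : ℕ) (z : Fin n → Fin K) => exists_isInducedEstimate A z
  let Clustering := Σ K : Fin (n + 1), {z : Fin n → Fin K // Function.Surjective z}
  have : Nonempty Clustering := ⟨⟨Fin.last n, id, Function.surjective_id⟩⟩
  obtain ⟨⟨K, z, hz⟩, hmin⟩ := Finite.exists_min
    fun i : Clustering => ‖A - P i.1 i.2.1‖ ^ 2 + pen i.1
  refine ⟨K, z, P K z, hz, hP K z, fun K' z' P' hz' hP' => ?_⟩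
  have hK' : K' ≤ n := by simpa using Fintype.card_le_of_surjective z' hz'
  rw [hP'.unique (hP K' z')]
  exact hmin ⟨⟨K', Nat.lt_succ_of_le hK'⟩, z', hz'⟩

end InducedEstimate

section Clusterings

/-- The price of searching over all the clusterings of `n` nodes into `K` clusters, at most `K ^ n`
in number, and over all the `n` possible values of `K`. -/
noncomputable def clusteringWeight (n K : ℕ) : ℝ :=
  Real.log n + n * Real.log K

theorem clusteringWeight_nonneg (n K : ℕ) : 0 ≤ clusteringWeight n K :=
  add_nonneg (Real.log_natCast_nonneg n) (mul_nonneg n.cast_nonneg (Real.log_natCast_nonneg K))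

theorem pow_mul_exp_neg_clusteringWeight {n K : ℕ} (hn : n ≠ 0) (hK : K ≠ 0) :
    (K : ℝ) ^ n * Real.exp (-clusteringWeight n K) = (n : ℝ)⁻¹ := by
  have hn' : (0 : ℝ) < n := by positivity
  have hK' : (0 : ℝ) < K := by positivity
  rw [clusteringWeight, neg_add, Real.exp_add, Real.exp_neg, Real.exp_neg, Real.exp_log hn',
    Real.exp_nat_mul, Real.exp_log hK']
  field_simp

theorem sum_exp_neg_clusteringWeight_le_one (n : ℕ) :
    ∑ i : Σ K : Fin (n + 1), (Fin n → Fin K), Real.exp (-clusteringWeight n i.1) ≤ 1 := by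
  rw [Fintype.sum_sigma]
  simp only [Finset.sum_const, Finset.card_univ, Fintype.card_fun, Fintype.card_fin, nsmul_eq_mul,
    Nat.cast_pow]
  obtain rfl | hn := eq_or_ne n 0
  · simp [clusteringWeight]
  · rw [Fin.sum_univ_succ]
    simp only [pow_mul_exp_neg_clusteringWeight hn (Fin.val_ne_zero_iff.2 (Fin.succ_ne_zero _))]
    simp [hn]

theorem IsSubgaussianVector.measure_exists_not_isControlledNoise_le {Ω : Type*} [MeasurableSpace Ω]
    {μ : Measure Ω} [IsProbabilityMeasure μ] {n : ℕ} {p w : Ω → EuclideanSpace ℝ (Fin n × Fin n)}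
    {τ : ℝ≥0} (hw : IsSubgaussianVector w τ μ) (hp : AEMeasurable p μ) (hpw : IndepFun p w μ)
    {t : ℝ} (ht : 0 ≤ t) :
    μ {ω | ¬ ∀ i : Σ K : Fin (n + 1), (Fin n → Fin K),
        IsControlledNoise (noiseFreeForms i.2) τ (clusteringWeight n i.1 + t) (p ω) (w ω)}
      ≤ ENNReal.ofReal (3 * Real.exp (-t)) := by
  simp only [not_forall, Set.ofPred_exists]
  calc μ (⋃ i : Σ K : Fin (n + 1), (Fin n → Fin K),
        {ω | ¬ IsControlledNoise (noiseFreeForms i.2) τ (clusteringWeight n i.1 + t) (p ω) (w ω)})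
      ≤ ∑ i : Σ K : Fin (n + 1), (Fin n → Fin K),
          3 * ENNReal.ofReal (Real.exp (-(clusteringWeight n i.1 + t))) :=
        (measure_iUnion_fintype_le _ _).trans (Finset.sum_le_sum fun i _ =>
          hw.measure_not_isControlledNoise_le hp hpw _
            (add_nonneg (clusteringWeight_nonneg _ _) ht))
    _ = ENNReal.ofReal (3 * Real.exp (-t) * ∑ i : Σ K : Fin (n + 1), (Fin n → Fin K),
          Real.exp (-clusteringWeight n i.1)) := by
        rw [Finset.mul_sum, ENNReal.ofReal_sum_of_nonneg fun _ _ => by positivity]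
        refine Finset.sum_congr rfl fun i _ => ?_
        rw [neg_add_rev, Real.exp_add, mul_assoc 3, ENNReal.ofReal_mul zero_le_three,
          ENNReal.ofReal_ofNat]
    _ ≤ ENNReal.ofReal (3 * Real.exp (-t)) :=
        ENNReal.ofReal_le_ofReal
          (mul_le_of_le_one_right (by positivity) (sum_exp_neg_clusteringWeight_le_one n))

end Clusterings

section Penalty

variable {C₁ C₂ C₃ c s : ℝ}

theorem penalty_nonneg (h₁ : 0 ≤ C₁) (h₂ : 0 ≤ C₂) (h₃ : 0 ≤ C₃) (hc : 0 ≤ c) (hs : 0 ≤ s)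
    (n K : ℕ) : 0 ≤ penalty C₁ C₂ C₃ c s n K := by
  have := Real.log_natCast_nonneg n
  have := Real.log_natCast_nonneg K
  unfold penalty
  positivity

theorem dimension_add_clusteringWeight_le_penalty (h₁ : 2 ≤ C₁) (h₂ : 0 ≤ C₂) (hc : 0 ≤ c)
    (h₃ : 4 / c ≤ C₃) (hs : 0 ≤ s) (n K : ℕ) :
    8 * s * (n * K) + 24 * s * clusteringWeight n K / c ≤ penalty C₁ C₂ C₃ c s n K := by
  have hdim : 8 * s * (n * K) ≤ 6 * s * (C₁ * n * K + C₂ * (K : ℝ) ^ 2 * Real.log n) := by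
    have := Real.log_natCast_nonneg n
    calc 8 * s * (n * K) ≤ 6 * s * (2 * n * K + 0) := by
          have : 0 ≤ s * (n * K) := by positivity
          linarith
      _ ≤ 6 * s * (C₁ * n * K + C₂ * (K : ℝ) ^ 2 * Real.log n) := by
          gcongr
          positivity
  have hweight : 24 * s * clusteringWeight n K / c
      ≤ (6 * C₃ + 2 / c) * s * clusteringWeight n K := by
    have := clusteringWeight_nonneg n K
    calc 24 * s * clusteringWeight n K / c = (6 * (4 / c) + 0) * s * clusteringWeight n K := by ring
      _ ≤ (6 * C₃ + 2 / c) * s * clusteringWeight n K := by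
          gcongr
          positivity
  exact add_le_add hdim hweight

end Penalty

theorem card_filter_mk_eq_le_two {V : Type*} [Fintype V] [DecidableEq V] (e : Sym2 V) :
    (Finset.univ.filter fun p : V × V => s(p.1, p.2) = e).card ≤ 2 := by
  induction e using Sym2.ind with
  | _ u v =>
    refine (Finset.card_le_card (t := {(u, v), (v, u)}) fun p hp => ?_).trans Finset.card_le_two
    simpa [Sym2.eq_iff, Prod.ext_iff] using hp

/-- The edges of the complete graph on `n` nodes. -/
abbrev Edge (n : ℕ) := {e : Sym2 (Fin n) // ¬ e.IsDiag}

namespace NormalLSM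

variable {n K : ℕ} (θ : NormalLSM n K)

theorem sigma_sq_le_sigmaMaxSq {u v : Fin n} (h : u ≠ v) :
    θ.σ (θ.label u) (θ.label v) ^ 2 ≤ θ.sigmaMaxSq :=
  le_ciSup (f := fun e : {e : Fin n × Fin n // e.1 ≠ e.2} =>
    θ.σ (θ.label e.1.1) (θ.label e.1.2) ^ 2) (Set.finite_range _).bddAbove ⟨(u, v), h⟩

theorem sigmaMaxSq_nonneg : 0 ≤ θ.sigmaMaxSq :=
  Real.iSup_nonneg fun _ => sq_nonneg _

/-- The effect on the network of a unit error on the edge `e`. -/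
noncomputable def edgeVec (e : Edge n) : EuclideanSpace ℝ (Fin n × Fin n) :=
  WithLp.toLp 2 fun p => if s(p.1, p.2) = e.1 then θ.σ (θ.label p.1) (θ.label p.2) else 0

theorem pairwise_inner_edgeVec_eq_zero :
    Pairwise fun e f => inner ℝ (θ.edgeVec e) (θ.edgeVec f) = 0 := by
  intro e f hef
  rw [PiLp.inner_apply]
  refine Finset.sum_eq_zero fun p _ => ?_
  by_cases he : s(p.1, p.2) = e.1
  · have hf : s(p.1, p.2) ≠ f.1 := fun hf => hef (Subtype.ext (he.symm.trans hf))
    simp [edgeVec, hf]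
  · simp [edgeVec, he]

/-- The sub-Gaussian variance proxy of the noise; the factor `2` is there because an edge fills two
entries of the matrix. -/
noncomputable def noiseProxy : ℝ≥0 := ⟨2 * θ.sigmaMaxSq, mul_nonneg zero_le_two θ.sigmaMaxSq_nonneg⟩

theorem coe_noiseProxy : (θ.noiseProxy : ℝ) = 2 * θ.sigmaMaxSq := rfl

theorem norm_sq_edgeVec_le (e : Edge n) : ‖θ.edgeVec e‖ ^ 2 ≤ θ.noiseProxy := by
  have hsum : ‖θ.edgeVec e‖ ^ 2
      = ∑ p : Fin n × Fin n with s(p.1, p.2) = e.1, θ.σ (θ.label p.1) (θ.label p.2) ^ 2 := by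
    rw [EuclideanSpace.real_norm_sq_eq, Finset.sum_filter]
    exact Finset.sum_congr rfl fun p _ => by simp only [edgeVec, ite_pow, zero_pow two_ne_zero]
  rw [hsum, coe_noiseProxy]
  calc ∑ p : Fin n × Fin n with s(p.1, p.2) = e.1, θ.σ (θ.label p.1) (θ.label p.2) ^ 2
      ≤ (Finset.univ.filter fun p : Fin n × Fin n => s(p.1, p.2) = e.1).card • θ.sigmaMaxSq := by
        refine Finset.sum_le_card_nsmul _ _ _ fun p hp =>
          θ.sigma_sq_le_sigmaMaxSq fun hdiag => e.2 ?_
        rw [← (Finset.mem_filter.1 hp).2]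
        exact Sym2.mk_isDiag_iff.2 hdiag
    _ ≤ 2 * θ.sigmaMaxSq := by
        rw [nsmul_eq_mul]
        exact mul_le_mul_of_nonneg_right (mod_cast card_filter_mk_eq_le_two e.1) θ.sigmaMaxSq_nonneg

/-- The noise-free network as a vector. -/
noncomputable def signal (Z : Fin n → ℝ) : EuclideanSpace ℝ (Fin n × Fin n) :=
  matrixVec (θ.noiseFree.network Z 0)

/-- The contribution of the edge errors to the network, as a vector. -/
noncomputable def noise (ε : Edge n → ℝ) : EuclideanSpace ℝ (Fin n × Fin n) :=
  ∑ e, ε e • θ.edgeVec e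

theorem continuous_signal : Continuous θ.signal := by
  refine (PiLp.continuous_toLp 2 _).comp (continuous_pi fun p => ?_)
  simp only [network, Matrix.of_apply]
  split_ifs <;> fun_prop

theorem continuous_noise : Continuous θ.noise := by
  unfold noise
  fun_prop

theorem matrixVec_noiseFree_network (Z : Fin n → ℝ) (ε : Sym2 (Fin n) → ℝ) :
    matrixVec (θ.noiseFree.network Z ε) = θ.signal Z := by
  simp [signal, network, noiseFree]

theorem noise_apply (ε : Sym2 (Fin n) → ℝ) (p : Fin n × Fin n) :
    θ.noise (fun e => ε e.1) p
      = if p.1 = p.2 then 0 else θ.σ (θ.label p.1) (θ.label p.2) * ε s(p.1, p.2) := by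
  rw [noise, WithLp.ofLp_sum, Finset.sum_apply]
  simp only [edgeVec, PiLp.smul_apply, smul_eq_mul, mul_ite, mul_zero]
  split_ifs with hdiag
  · refine Finset.sum_eq_zero fun e _ => if_neg fun he => e.2 ?_
    exact he ▸ Sym2.mk_isDiag_iff.2 hdiag
  · rw [Finset.sum_eq_single ⟨s(p.1, p.2), fun h => hdiag (Sym2.mk_isDiag_iff.1 h)⟩]
    · rw [if_pos rfl, mul_comm]
    · exact fun e _ he => if_neg fun h => he (Subtype.ext h.symm)
    · exact fun h => absurd (Finset.mem_univ _) h

theorem matrixVec_network (Z : Fin n → ℝ) (ε : Sym2 (Fin n) → ℝ) :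
    matrixVec (θ.network Z ε) = θ.signal Z + θ.noise fun e => ε e.1 := by
  ext p
  rw [PiLp.add_apply, noise_apply, signal, matrixVec_apply, matrixVec_apply]
  by_cases hdiag : p.1 = p.2 <;> simp [network, noiseFree, hdiag]

theorem isNoiseFreeForm_noiseFree_network (Z : Fin n → ℝ) (ε : Sym2 (Fin n) → ℝ) :
    IsNoiseFreeForm θ.label (θ.noiseFree.network Z ε) :=
  ⟨θ.γ, θ.α, θ.β, fun u _ => Z u, θ.γ_symm, θ.β_eq, fun u v => by simp [network, noiseFree]⟩

variable {Khat : ℕ} {z : Fin n → Fin Khat} {P : Matrix (Fin n) (Fin n) ℝ} {Z : Fin n → ℝ}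
  {ε : Sym2 (Fin n) → ℝ}

theorem norm_sq_sub_add_le_of_isPenalizedEstimate {pen : ℕ → ℝ}
    (h : IsPenalizedEstimate pen (θ.network Z ε) Khat z P) :
    ‖θ.network Z ε - P‖ ^ 2 + pen Khat
      ≤ ‖θ.network Z ε - θ.noiseFree.network Z ε‖ ^ 2 + pen K := by
  obtain ⟨-, -, hmin⟩ := h
  obtain ⟨Q, hQ⟩ := exists_isInducedEstimate (θ.network Z ε) θ.label
  calc ‖θ.network Z ε - P‖ ^ 2 + pen Khat ≤ ‖θ.network Z ε - Q‖ ^ 2 + pen K :=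
        hmin K θ.label Q θ.label_surjective hQ
    _ ≤ ‖θ.network Z ε - θ.noiseFree.network Z ε‖ ^ 2 + pen K := by
        gcongr
        exact hQ.2 _ (θ.isNoiseFreeForm_noiseFree_network Z ε)

theorem norm_sq_sub_le_of_isControlledNoise {C₁ C₂ C₃ c t : ℝ} (h₁ : 2 ≤ C₁) (h₂ : 0 ≤ C₂)
    (hc : 0 < c) (hc1 : c < 1) (h₃ : 4 / c ≤ C₃) (ht : 0 ≤ t)
    (hnoise : IsControlledNoise (noiseFreeForms z) θ.noiseProxy (clusteringWeight n Khat + t)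
      (θ.signal Z) (θ.noise fun e => ε e.1))
    (h : IsPenalizedEstimate (penalty C₁ C₂ C₃ c θ.sigmaMaxSq n) (θ.network Z ε) Khat z P) :
    ‖P - θ.noiseFree.network Z ε‖ ^ 2
      ≤ (1 - c)⁻¹ * penalty C₁ C₂ C₃ c θ.sigmaMaxSq n K + 48 / c * θ.sigmaMaxSq * t := by
  have hP := isInducedEstimate_iff_eq_starProjection.1 h.2.1
  have hcompare := θ.norm_sq_sub_add_le_of_isPenalizedEstimate h
  have hs := θ.sigmaMaxSq_nonneg
  have hC₃ : 0 ≤ C₃ := le_trans (by positivity) h₃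
  rw [← norm_matrixVec_sub, ← norm_matrixVec_sub, hP, matrixVec_noiseFree_network,
    matrixVec_network, add_sub_cancel_left] at hcompare
  rw [← norm_matrixVec_sub, hP, matrixVec_noiseFree_network, matrixVec_network]
  refine (hnoise.norm_sq_starProjection_add_sub_le hc hc1 (clusteringWeight_nonneg n Khat) ht
    (penalty_nonneg (by linarith) h₂ hC₃ hc.le hs n K) ?_ hcompare).trans_eq ?_
  · have hdim : (Module.finrank ℝ (noiseFreeForms z) : ℝ) ≤ n * Khat :=
      mod_cast finrank_noiseFreeForms_le z
    rw [coe_noiseProxy]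
    calc 4 * (2 * θ.sigmaMaxSq) * Module.finrank ℝ (noiseFreeForms z)
          + 12 * (2 * θ.sigmaMaxSq) * clusteringWeight n Khat / c
        ≤ 4 * (2 * θ.sigmaMaxSq) * (n * Khat)
          + 12 * (2 * θ.sigmaMaxSq) * clusteringWeight n Khat / c := by gcongr
      _ = 8 * θ.sigmaMaxSq * (n * Khat) + 24 * θ.sigmaMaxSq * clusteringWeight n Khat / c := by ring
      _ ≤ _ := dimension_add_clusteringWeight_le_penalty h₁ h₂ hc.le h₃ hs n Khat
  · rw [coe_noiseProxy]
    ring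

end NormalLSM

/-- Inputs more general than those of `IsStandardNormalInput`: arbitrary random sociabilities,
independent of the edge errors, which are themselves independent and `1`-sub-Gaussian (in particular
centered). -/
structure IsSubgaussianInput {Ω : Type*} [MeasurableSpace Ω] (μ : Measure Ω) {n : ℕ}
    (Z : Fin n → Ω → ℝ) (ε : Sym2 (Fin n) → Ω → ℝ) : Prop where
  aemeasurable_Z : ∀ u, AEMeasurable (Z u) μ
  hasSubgaussianMGF_ε : ∀ e : Edge n, HasSubgaussianMGF (ε e.1) 1 μ
  iIndepFun_ε : iIndepFun (fun e : Edge n => ε e.1) μ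
  indepFun : IndepFun (fun ω u => Z u ω) (fun ω (e : Edge n) => ε e.1 ω) μ

section Input

variable {Ω : Type*} [MeasurableSpace Ω] {μ : Measure Ω} {n K : ℕ} {Z : Fin n → Ω → ℝ}
  {ε : Sym2 (Fin n) → Ω → ℝ}

theorem IsStandardNormalInput.isSubgaussianInput (h : IsStandardNormalInput μ Z ε) :
    IsSubgaussianInput μ Z ε where
  aemeasurable_Z u := (h.law_Z u).aemeasurable
  hasSubgaussianMGF_ε e := hasSubgaussianMGF_of_hasLaw_gaussianReal (h.law_ε e.1 e.2)
  iIndepFun_ε := h.indep.precomp Sum.inr_injective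
  indepFun := indepFun_sumElim h.indep (fun u => (h.law_Z u).aemeasurable)
    fun e => (h.law_ε e.1 e.2).aemeasurable

namespace IsSubgaussianInput

variable (h : IsSubgaussianInput μ Z ε) (θ : NormalLSM n K)
include h

theorem isSubgaussianVector_noise :
    IsSubgaussianVector (fun ω => θ.noise fun e => ε e.1 ω) θ.noiseProxy μ :=
  isSubgaussianVector_sum_smul h.iIndepFun_ε h.hasSubgaussianMGF_ε
    (sum_inner_sq_le_of_pairwise_orthogonal θ.pairwise_inner_edgeVec_eq_zero θ.norm_sq_edgeVec_le)

theorem aemeasurable_signal : AEMeasurable (fun ω => θ.signal fun u => Z u ω) μ :=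
  θ.continuous_signal.measurable.comp_aemeasurable (aemeasurable_pi_lambda _ h.aemeasurable_Z)

theorem indepFun_signal_noise :
    IndepFun (fun ω => θ.signal fun u => Z u ω) (fun ω => θ.noise fun e => ε e.1 ω) μ :=
  h.indepFun.comp θ.continuous_signal.measurable θ.continuous_noise.measurable

end IsSubgaussianInput

end Input

theorem theorem1_general {n Kstar : ℕ} (θ : NormalLSM n Kstar) {Ω : Type*} [MeasurableSpace Ω]
    {μ : Measure Ω} [IsProbabilityMeasure μ] {Z : Fin n → Ω → ℝ} {ε : Sym2 (Fin n) → Ω → ℝ}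
    (hinput : IsSubgaussianInput μ Z ε) {C₁ C₂ C₃ c : ℝ} (h₁ : 2 ≤ C₁) (h₂ : 0 ≤ C₂) (hc : 0 < c)
    (hc1 : c < 1) (h₃ : 4 / c ≤ C₃) :
    (∀ ω, ∃ (Khat : ℕ) (zhat : Fin n → Fin Khat) (Phat : Matrix (Fin n) (Fin n) ℝ),
      IsPenalizedEstimate (penalty C₁ C₂ C₃ c θ.sigmaMaxSq n)
        (θ.network (fun u => Z u ω) (fun e => ε e ω)) Khat zhat Phat) ∧
    ∀ t : ℝ, 0 < t →
      ∃ E : Set Ω, MeasurableSet E ∧ 1 - 3 * Real.exp (-t) ≤ μ.real E ∧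
        ∀ ω ∈ E, ∀ (Khat : ℕ) (zhat : Fin n → Fin Khat) (Phat : Matrix (Fin n) (Fin n) ℝ),
          IsPenalizedEstimate (penalty C₁ C₂ C₃ c θ.sigmaMaxSq n)
              (θ.network (fun u => Z u ω) (fun e => ε e ω)) Khat zhat Phat →
            ‖Phat - θ.noiseFree.network (fun u => Z u ω) (fun e => ε e ω)‖ ^ 2
              ≤ (1 - c)⁻¹ * penalty C₁ C₂ C₃ c θ.sigmaMaxSq n Kstar
                + 48 / c * θ.sigmaMaxSq * t := by
  refine ⟨fun ω => exists_isPenalizedEstimate _ _, fun t ht => ?_⟩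
  obtain ⟨E, hE, hμE, hcontrolled⟩ := exists_measurableSet_one_sub_le_measureReal (by positivity)
    ((hinput.isSubgaussianVector_noise θ).measure_exists_not_isControlledNoise_le
      (hinput.aemeasurable_signal θ) (hinput.indepFun_signal_noise θ) ht.le)
  refine ⟨E, hE, hμE, fun ω hω Khat zhat Phat h => ?_⟩
  have hKhat : Khat ≤ n := by simpa using Fintype.card_le_of_surjective zhat h.1
  exact θ.norm_sq_sub_le_of_isControlledNoise h₁ h₂ hc hc1 h₃ ht.le
    (hcontrolled ω hω ⟨⟨Khat, Nat.lt_succ_of_le hKhat⟩, zhat⟩) h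

theorem theorem1 :
    ∃ C₀ : ℝ, 0 < C₀ ∧
      ∀ C₁ C₂ C₃ c : ℝ, C₀ ≤ C₁ → C₀ ≤ C₂ → 0 < c → c < 1 → C₀ / c ≤ C₃ →
      ∀ (n Kstar : ℕ) (θ : NormalLSM n Kstar)
        (Ω : Type*) [MeasurableSpace Ω] (μ : Measure Ω) [IsProbabilityMeasure μ]
        (Z : Fin n → Ω → ℝ) (ε : Sym2 (Fin n) → Ω → ℝ)
        (A Pstar : Ω → Matrix (Fin n) (Fin n) ℝ) (pen : ℕ → ℝ),
        IsStandardNormalInput μ Z ε →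
        (∀ ω, A ω = θ.network (fun u => Z u ω) (fun e => ε e ω)) →
        (∀ ω, Pstar ω = θ.noiseFree.network (fun u => Z u ω) (fun e => ε e ω)) →
        (∀ K, pen K = penalty C₁ C₂ C₃ c θ.sigmaMaxSq n K) →
        (∀ ω, ∃ (Khat : ℕ) (zhat : Fin n → Fin Khat) (Phat : Matrix (Fin n) (Fin n) ℝ),
          IsPenalizedEstimate pen (A ω) Khat zhat Phat) ∧
        ∀ t : ℝ, 0 < t →
          ∃ E : Set Ω, MeasurableSet E ∧ 1 - 3 * Real.exp (-t) ≤ μ.real E ∧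
            ∀ ω ∈ E, ∀ (Khat : ℕ) (zhat : Fin n → Fin Khat) (Phat : Matrix (Fin n) (Fin n) ℝ),
              IsPenalizedEstimate pen (A ω) Khat zhat Phat →
                ‖Phat - Pstar ω‖ ^ 2
                  ≤ (1 - c)⁻¹ * pen Kstar + C₀ / c * θ.sigmaMaxSq * t := by
  refine ⟨48, by norm_num, ?_⟩
  intro C₁ C₂ C₃ c h₁ h₂ hc hc1 h₃ n Kstar θ Ω _ μ _ Z ε A Pstar pen hinput hA hPstar hpen
  obtain rfl := funext hA
  obtain rfl := funext hPstar
  obtain rfl := funext hpen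
  exact theorem1_general θ hinput.isSubgaussianInput (by linarith) (by linarith) hc hc1
    (le_trans (by gcongr; norm_num) h₃)
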